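/- **Planning instances.** Fix a finite set $\mathcal R$ of relation symbols with arities and a finite set $\mathcal O$ of objects, $\omega=|\mathcal O|$. Ground atoms are the expressions $r(o_1,\dots,o_n)$ with $n=\mathrm{arity}(r)$; a logical state is a set of ground atoms. An instantaneous action schema $\alpha$ has a finite set $V_\alpha$ of free arguments and finite sets $Pre^+_\alpha, Pre^-_\alpha, Eff^+_\alpha, Eff^-_\alpha$ of literals $\forall v_1,\dots,v_k:\ r(v'_1,\dots,v'_n)$, where the $v_i$ occur among the $v'_j$ and the other $v'_j$ lie in $V_\alpha$ (literals are identified up to renaming of quantified arguments; a literal with $k=0$ is called simple). A durative schema is a triple $D\alpha=(\alpha^{st},\alpha^{inv},\alpha^{end})$ of schemas with the same free arguments, where $\alpha^{inv}$ has no effects. A domain consists of a finite set $\mathcal A^i$ of instantaneous schemas and a finite set $\mathcal A^d$ of durative schemas; $\mathcal A$ is the family of all members of $\mathcal A^i$ and all fragments of members of $\mathcal A^d$. A grounding $gr:V_\alpha\to\mathcal O$ is injective; $gr(l)$ is the set of atoms obtained from a literal $l$ by applying $gr$ to the free arguments and substituting objects for the quantified ones in all possible ways, $gr(M)=\bigcup_{l\in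 M}gr(l)$, and $gr(\alpha)$ is the ground action with preconditions $gr(Pre^\pm_\alpha)$ and effects $gr(Eff^\pm_\alpha)$; all fragments of a durative schema are grounded by the same $gr$. A ground action $a$ is applicable in $s$ if $Pre_a^+\subseteq s$ and $Pre_a^-\cap s=\emptyset$, and then leads to $(s\setminus Eff_a^-)\cup Eff_a^+$. Ground actions $a,b$ are non-interfering if $(Pre^+_a\cup Pre^-_a)\cap(Eff_b^+\cup Eff_b^-)=\emptyset$, $Eff_a^+\cap Eff_b^-=\emptyset$, and the same holds with $a,b$ exchanged. **Plans.** A plan is a finite collection, with multiplicities, of instantaneous ground actions at rational times $t$ and of durative ground actions $Da$ with rational start $t$ and rational length $t'\ge 0$; all times $t$ are greater than the initial time $t_0$. Its happening times are $t_0$ and all starts and ends. The induced simple plan consists of the occurrences $(t,a)$ of the instantaneous actions, and, for each durative one, $(t,a^{st})$, $(t+t',a^{end})$ and $((t_i+t_{i+1})/2,a^{inv})$ for all consecutive happening times $t_i<t_{i+1}$ with $t\le t_i<t+t'$. It is executable if, starting from $Init$ and going through the times at which some action occurs in increasing order, all actions that occur at the current time are applicable in the current state $s$, any two distinct occurrences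 at that time (also of one and the same action) are non-interfering, and the next state is $(s\setminus\bigcup Eff_a^-)\cup\bigcup Eff_a^+$. It is valid if moreover the last state is a goal state. A state is reachable if it appears in the trace of a valid plan. **Templates.** A component is a triple $c=\langle r,a,p\rangle$ with $a=\mathrm{arity}(r)$ and $p\in\{0,\dots,a\}$ (the counted position; $p=a$ means that there is none); its fixed arguments are the pairs $(c,i)$ with $0\le i<a$, $i\ne p$. A template $\mathcal T$ is a finite set of components together with a partition $\mathcal F$ of their fixed arguments, each part of which contains exactly one fixed argument of every component; $\sim_{\mathcal F}$ means lying in the same part. Distinct components are assumed to have distinct relation symbols. An instance $\gamma$ maps fixed arguments to objects so that $\gamma(c,i)=\gamma(c',j)$ iff $(c,i)\sim_{\mathcal F}(c',j)$; $\gamma(\mathcal T)$ is the set of all atoms $r(o_0,\dots,o_{a-1})$ with $\langle r,a,p\rangle=c$ a component and $o_i=\gamma(c,i)$ for all $i\neq p$. The weight of a state $s$ is $w(\mathcal T,\gamma,s)=|s\cap\gamma(\mathcal T)|$. $\mathcal T$ is invariant if for every $\gamma$ at most one atom of $\gamma(\mathcal T)$ is true in any reachable state. **Pure schemas.** A literal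 $l$ matches $\mathcal T$ via $c=\langle r,a,p\rangle$ if its relation symbol is $r$ and, when $l$ is quantified, its set of quantified positions is $\{p\}$. Two literals $l,l'$ that match via $c,c'$ are $\mathcal T$-coupled if the argument of $l$ at position $i$ equals the argument of $l'$ at position $j$ whenever $(c,i)\sim_{\mathcal F}(c',j)$. This is an equivalence relation on the matching literals of a schema (or of all the fragments of a durative schema); its classes are the $\mathcal T$-classes $L$. $\alpha_L$ is the schema obtained from $\alpha$ by keeping only the literals in $L$; $D\alpha_L$ is the triple of the $\alpha^{x}_L$. The weight $w(A)$ of a set $A$ of literals is the sum of $1$ for each simple and $\omega$ for each quantified literal of $A$. $\alpha_L$ is *irrelevant* if $w(Pre^+_{\alpha_L})\le1$ and $w(Eff^+_{\alpha_L})=0$; *relevant* if $w(Pre^+_{\alpha_L})\le1$ and $w(Eff^+_{\alpha_L})=1$; *relevant balanced* if moreover $w(Pre^+_{\alpha_L})=1$ and $Pre^+_{\alpha_L}\subseteq Eff^+_{\alpha_L}\cup Eff^-_{\alpha_L}$; *relevant unbounded* if it is relevant, $w(Pre^+_{\alpha_L})=0$, and there is a component $c$ such that the literals of $\alpha_L$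 that match via $c$ have total weight less than $w_c$, where $w_c=\omega$ if $c$ has a counted argument and $w_c=1$ otherwise. A schema is *strongly safe* if, for each of its groundings $a$ and each instance $\gamma$, applying $a$ in a state of weight at most $1$ in which it is applicable gives a state of weight at most $1$. $D\alpha_L$ is strongly safe if its three fragments are. The auxiliary schema $D\alpha_*=(\alpha^{st}_*,\alpha^{end}_*)$ has the effects of $\alpha^{st}$ and $\alpha^{end}$ and the preconditions $Pre^\pm_{\alpha^{st}_*}=Pre^\pm_{\alpha^{st}}\cup(Pre^\pm_{\alpha^{inv}}\setminus Eff^\pm_{\alpha^{st}})$ and $Pre^\pm_{\alpha^{end}_*}=Pre^\pm_{\alpha^{end}}\cup Pre^\pm_{\alpha^{inv}}$; $D\alpha_{*L}=(\alpha^{st}_{*L},\alpha^{end}_{*L})$ is its restriction to $L$. $D\alpha_{*L}$ is *reachable* if each of its groundings can be executed in sequence from some state and $w\bigl(Pre^+_{\alpha^{st}_{*L}}\cup(Pre^+_{\alpha^{end}_{*L}}\setminus Eff^+_{\alpha^{st}_{*L}})\bigr)\le 1$. It is *simply safe of type (a)* if it is reachable, $\alpha^{st}_{*L}$ is strongly safe,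 $\alpha^{end}_{*L}$ is relevant unbounded, $\alpha^{st}_{*L}$ is irrelevant, $w(Pre^+_{\alpha^{st}_{*L}})=1$ and $Pre^+_{\alpha^{st}_{*L}}\subseteq Eff^-_{\alpha^{st}_{*L}}$. **Corollary.** Let $\mathcal T$ be a template such that $w(\mathcal T,\gamma,Init)\le1$ for every instance $\gamma$, and such that every add effect of a schema in $\mathcal A$ whose relation symbol occurs in $\mathcal T$ matches $\mathcal T$. Suppose that 1. for every $D\alpha\in\mathcal A^d$ and every $\mathcal T$-class $L$ of its literals such that $D\alpha_L$ is not strongly safe, $D\alpha_{*L}$ is simply safe of type (a); 2. for every $\alpha\in\mathcal A$ and every $\mathcal T$-class $L$, unless $\alpha_L$ is the start or end fragment of a $D\alpha_L$ that is not strongly safe, $\alpha_L$ is irrelevant or relevant balanced. Then $\mathcal T$ is invariant. -/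

import Mathlib

namespace TemporalPlanning

universe u v w

/-! ### Literals, schemas and ground actions -/

/-- A ground atom `r(o₁, …, oₙ)`. -/
structure Atom {R : Type u} (ar : R → ℕ) (O : Type v) where
  rel : R
  args : Fin (ar rel) → O

/-- A logical state: a set of ground atoms. -/
abbrev State {R : Type u} (ar : R → ℕ) (O : Type v) := Set (Atom ar O)

/-- A literal `∀ v₁ … vₖ : r(…)` with free arguments in `V`. An argument is either a free argument
(`Sum.inl`) or a quantified one (`Sum.inr`). Literals are identified up to renaming of quantified
arguments: a quantified argument is named by the first position at which it occurs. -/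
structure Literal {R : Type u} (ar : R → ℕ) (V : Type w) where
  rel : R
  arg : Fin (ar rel) → V ⊕ Fin (ar rel)
  canonical : ∀ i k, arg i = Sum.inr k → k ≤ i ∧ arg k = Sum.inr k

noncomputable instance {R : Type u} (ar : R → ℕ) (V : Type w) : DecidableEq (Literal ar V) :=
  Classical.decEq _

/-- `Arg[i, l]`, the argument at position `i` (`none` if there is no such position). -/
def Literal.argAt {R : Type u} {ar : R → ℕ} {V : Type w} (l : Literal ar V) (i : ℕ) :
    Option (V ⊕ ℕ) :=
  if h : i < ar l.rel then some (Sum.map id (fun k => (k : ℕ)) (l.arg ⟨i, h⟩)) else none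

/-- The set of positions of the quantified arguments. -/
def Literal.quantPos {R : Type u} {ar : R → ℕ} {V : Type w} (l : Literal ar V) : Set ℕ :=
  {i | ∃ k, l.argAt i = some (Sum.inr k)}

/-- The set of ground atoms of a literal: free arguments are replaced according to `gr`, quantified
arguments by objects in all possible ways. -/
def Literal.ground {R : Type u} {ar : R → ℕ} {V : Type w} {O : Type v} (l : Literal ar V)
    (gr : V → O) : Set (Atom ar O) :=
  {A | ∃ σ : Fin (ar l.rel) → O, A = ⟨l.rel, fun i => Sum.elim gr σ (l.arg i)⟩}

/-- An instantaneous action schema with free arguments `V`. -/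
structure ActionSchema {R : Type u} (ar : R → ℕ) (V : Type w) where
  prePos : Finset (Literal ar V)
  preNeg : Finset (Literal ar V)
  addEff : Finset (Literal ar V)
  delEff : Finset (Literal ar V)

/-- The set of all literals that appear in the schema. -/
noncomputable def ActionSchema.literals {R : Type u} {ar : R → ℕ} {V : Type w}
    (α : ActionSchema ar V) : Finset (Literal ar V) :=
  α.prePos ∪ α.preNeg ∪ α.addEff ∪ α.delEff

/-- `α_L`: only the literals in `L` are kept. -/
noncomputable def ActionSchema.restrict {R : Type u} {ar : R → ℕ} {V : Type w}
    (α : ActionSchema ar V) (L : Finset (Literal ar V)) : ActionSchema ar V where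
  prePos := α.prePos ∩ L
  preNeg := α.preNeg ∩ L
  addEff := α.addEff ∩ L
  delEff := α.delEff ∩ L

/-- A durative action schema: a triple of schemas on the same free arguments; the middle one
collects the conditions that hold over all the duration and has no effects. -/
structure DurativeSchema {R : Type u} (ar : R → ℕ) (V : Type w) where
  st : ActionSchema ar V
  inv : ActionSchema ar V
  fin : ActionSchema ar V
  inv_addEff : inv.addEff = ∅
  inv_delEff : inv.delEff = ∅

noncomputable def DurativeSchema.literals {R : Type u} {ar : R → ℕ} {V : Type w}
    (δ : DurativeSchema ar V) : Finset (Literal ar V) :=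
  δ.st.literals ∪ δ.inv.literals ∪ δ.fin.literals

/-- The auxiliary start schema. -/
noncomputable def DurativeSchema.stAux {R : Type u} {ar : R → ℕ} {V : Type w}
    (δ : DurativeSchema ar V) : ActionSchema ar V where
  prePos := δ.st.prePos ∪ (δ.inv.prePos \ δ.st.addEff)
  preNeg := δ.st.preNeg ∪ (δ.inv.preNeg \ δ.st.delEff)
  addEff := δ.st.addEff
  delEff := δ.st.delEff

/-- The auxiliary end schema. -/
noncomputable def DurativeSchema.finAux {R : Type u} {ar : R → ℕ} {V : Type w}
    (δ : DurativeSchema ar V) : ActionSchema ar V where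
  prePos := δ.fin.prePos ∪ δ.inv.prePos
  preNeg := δ.fin.preNeg ∪ δ.inv.preNeg
  addEff := δ.fin.addEff
  delEff := δ.fin.delEff

/-- A ground action over a set `Λ` of ground atoms. -/
structure GroundAction (Λ : Type*) where
  prePos : Set Λ
  preNeg : Set Λ
  addEff : Set Λ
  delEff : Set Λ

def GroundAction.Applicable {Λ : Type*} (a : GroundAction Λ) (s : Set Λ) : Prop :=
  a.prePos ⊆ s ∧ a.preNeg ∩ s = ∅

/-- The state `ξ(s, a)`. -/
def GroundAction.result {Λ : Type*} (a : GroundAction Λ) (s : Set Λ) : Set Λ :=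
  (s \ a.delEff) ∪ a.addEff

/-- Two ground actions that do not interfere (the no moving targets rule). -/
def GroundAction.NonInterfering {Λ : Type*} (a b : GroundAction Λ) : Prop :=
  (a.prePos ∪ a.preNeg) ∩ (b.addEff ∪ b.delEff) = ∅ ∧
  (b.prePos ∪ b.preNeg) ∩ (a.addEff ∪ a.delEff) = ∅ ∧
  a.addEff ∩ b.delEff = ∅ ∧ b.addEff ∩ a.delEff = ∅

/-- The ground action `gr(α)`. Groundings are injective. -/
def ActionSchema.ground {R : Type u} {ar : R → ℕ} {V : Type w} {O : Type v}
    (α : ActionSchema ar V) (gr : V ↪ O) : GroundAction (Atom ar O) where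
  prePos := ⋃ l ∈ α.prePos, l.ground gr
  preNeg := ⋃ l ∈ α.preNeg, l.ground gr
  addEff := ⋃ l ∈ α.addEff, l.ground gr
  delEff := ⋃ l ∈ α.delEff, l.ground gr

/-! ### Planning instances, plans and reachable states -/

/-- A planning domain over the relation symbols `R` with arities `ar`: finitely many instantaneous
and durative action schemas. -/
structure Domain {R : Type u} (ar : R → ℕ) where
  Inst : Type
  Dur : Type
  finite_inst : Finite Inst
  finite_dur : Finite Dur
  instVars : Inst → ℕ
  durVars : Dur → ℕ
  inst : (i : Inst) → ActionSchema ar (Fin (instVars i))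
  dur : (d : Dur) → DurativeSchema ar (Fin (durVars d))

/-- A planning problem on the objects `O`: initial time, initial logical state, goal states. -/
structure Problem {R : Type u} (ar : R → ℕ) (O : Type v) where
  t₀ : ℚ
  init : State ar O
  goal : Set (State ar O)

/-- A timed action: an instantaneous ground action at time `t`, or a durative ground action that
starts at time `t` and lasts `len`. -/
inductive TimedAction {R : Type u} {ar : R → ℕ} (D : Domain ar) (O : Type v) where
  | inst (t : ℚ) (i : D.Inst) (gr : Fin (D.instVars i) ↪ O) : TimedAction D O
  | dur (t : ℚ) (d : D.Dur) (gr : Fin (D.durVars d) ↪ O) (len : ℚ) : TimedAction D O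

def TimedAction.time {R : Type u} {ar : R → ℕ} {D : Domain ar} {O : Type v} :
    TimedAction D O → ℚ
  | .inst t _ _ => t
  | .dur t _ _ _ => t

def TimedAction.length {R : Type u} {ar : R → ℕ} {D : Domain ar} {O : Type v} :
    TimedAction D O → ℚ
  | .inst _ _ _ => 0
  | .dur _ _ _ len => len

/-- A plan: a finite collection (with multiplicities) of timed actions that start after the
initial time and have non-negative lengths. -/
structure Plan {R : Type u} {ar : R → ℕ} {O : Type v} (D : Domain ar) (P : Problem ar O) where
  n : ℕ
  act : Fin n → TimedAction D O
  time_pos : ∀ j, P.t₀ < (act j).time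
  length_nonneg : ∀ j, 0 ≤ (act j).length

/-- The happening times of a plan: the initial time, and all times at which an action starts or
ends. -/
def Plan.times {R : Type u} {ar : R → ℕ} {O : Type v} {D : Domain ar} {P : Problem ar O}
    (π : Plan D P) : Set ℚ :=
  {P.t₀} ∪ {t | ∃ j, t = (π.act j).time ∨ t = (π.act j).time + (π.act j).length}

/-- `x` and `y` are consecutive elements of `T`. -/
def Consecutive (T : Set ℚ) (x y : ℚ) : Prop :=
  x ∈ T ∧ y ∈ T ∧ x < y ∧ ∀ z ∈ T, ¬ (x < z ∧ z < y)

/-- The role in which a ground action occurs in an induced simple plan. -/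
inductive Role where
  | whole | st | inv | fin

/-- A simple plan: a collection of timed ground actions `(t, a)`. Each occurrence carries a label
in `I`, so that two occurrences of one action at one time are told apart. -/
abbrev SimplePlan (I : Type*) (Λ : Type*) := Set (I × ℚ × GroundAction Λ)

/-- The timed ground actions of the simple plan induced by a plan. The `j`-th timed action
contributes itself if it is instantaneous, otherwise its start, its end, and its overall conditions
half-way between consecutive happening times within its duration. -/
inductive Plan.Induced {R : Type u} {ar : R → ℕ} {O : Type v} {D : Domain ar} {P : Problem ar O}
    (π : Plan D P) : Fin π.n → Role → ℚ → GroundAction (Atom ar O) → Prop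
  | whole (j : Fin π.n) (t : ℚ) (i : D.Inst) (gr : Fin (D.instVars i) ↪ O) (τ : ℚ) :
      π.act j = .inst t i gr → τ = t →
      Plan.Induced π j .whole τ ((D.inst i).ground gr)
  | st (j : Fin π.n) (t : ℚ) (d : D.Dur) (gr : Fin (D.durVars d) ↪ O) (len τ : ℚ) :
      π.act j = .dur t d gr len → τ = t →
      Plan.Induced π j .st τ ((D.dur d).st.ground gr)
  | fin (j : Fin π.n) (t : ℚ) (d : D.Dur) (gr : Fin (D.durVars d) ↪ O) (len τ : ℚ) :
      π.act j = .dur t d gr len → τ = t + len →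
      Plan.Induced π j .fin τ ((D.dur d).fin.ground gr)
  | inv (j : Fin π.n) (t : ℚ) (d : D.Dur) (gr : Fin (D.durVars d) ↪ O) (len x y τ : ℚ) :
      π.act j = .dur t d gr len → Consecutive π.times x y → t ≤ x → x < t + len →
      τ = (x + y) / 2 →
      Plan.Induced π j .inv τ ((D.dur d).inv.ground gr)

def Plan.induced {R : Type u} {ar : R → ℕ} {O : Type v} {D : Domain ar} {P : Problem ar O}
    (π : Plan D P) : SimplePlan (Fin π.n × Role) (Atom ar O) :=
  {x | π.Induced x.1.1 x.1.2 x.2.1 x.2.2}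

/-- The happening at time `t`: the collection of the action occurrences at time `t`. -/
def SimplePlan.happening {I Λ : Type*} (π : SimplePlan I Λ) (t : ℚ) : Set (I × GroundAction Λ) :=
  {x | (x.1, t, x.2) ∈ π}

/-- Concurrent action occurrences can be executed in `s`: each is applicable, and any two
distinct ones are non-interfering. -/
def HappeningApplicable {I Λ : Type*} (A : Set (I × GroundAction Λ)) (s : Set Λ) : Prop :=
  (∀ x ∈ A, x.2.Applicable s) ∧ A.Pairwise (fun x y => x.2.NonInterfering y.2)

/-- The state `ξ(s, A)`. -/
def happeningResult {I Λ : Type*} (A : Set (I × GroundAction Λ)) (s : Set Λ) : Set Λ :=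
  (s \ ⋃ x ∈ A, x.2.delEff) ∪ ⋃ x ∈ A, x.2.addEff

/-- `(t i, s i)`, `i = 0, …, k`, is the trace of the simple plan `π` from the state `s₀` at time
`t₀`. -/
structure SimplePlan.IsTrace {I Λ : Type*} (π : SimplePlan I Λ) (t₀ : ℚ) (s₀ : Set Λ) (k : ℕ)
    (t : Fin (k + 1) → ℚ) (s : Fin (k + 1) → Set Λ) : Prop where
  strictMono : StrictMono t
  range_eq : Set.range t = {t₀} ∪ {τ | (π.happening τ).Nonempty}
  time_zero : t 0 = t₀
  state_zero : s 0 = s₀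
  applicable : ∀ i : Fin k, HappeningApplicable (π.happening (t i.succ)) (s i.castSucc)
  state_succ : ∀ i : Fin k, s i.succ = happeningResult (π.happening (t i.succ)) (s i.castSucc)

/-- The reachable states: those in the trace of a valid (executable and goal-reaching) plan. -/
def Reachable {R : Type u} {ar : R → ℕ} {O : Type v} (D : Domain ar) (P : Problem ar O) :
    Set (State ar O) :=
  {s | ∃ (π : Plan D P) (k : ℕ) (t : Fin (k + 1) → ℚ) (S : Fin (k + 1) → State ar O),
    π.induced.IsTrace P.t₀ P.init k t S ∧ S (Fin.last k) ∈ P.goal ∧ ∃ i, S i = s}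

/-! ### Templates -/

/-- A component `⟨r, a, p⟩` with `a = ar r`; `p = a` means that there is no counted argument. -/
structure Component {R : Type u} (ar : R → ℕ) where
  rel : R
  pos : ℕ
  pos_le : pos ≤ ar rel

/-- The labelled fixed arguments `(c, i)` of a set of components. -/
def FixedArg {R : Type u} {ar : R → ℕ} (C : Finset (Component ar)) :=
  {x : Component ar × ℕ // x.1 ∈ C ∧ x.2 < ar x.1.rel ∧ x.2 ≠ x.1.pos}

/-- A template: a finite set of components with an admissible partition of its fixed arguments,
that is, every part contains exactly one fixed argument of every component. -/
structure Template {R : Type u} (ar : R → ℕ) where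
  comps : Finset (Component ar)
  parts : Set (Set (FixedArg comps))
  isPartition : Setoid.IsPartition parts
  admissible : ∀ G ∈ parts, ∀ c ∈ comps, ∃! x, x ∈ G ∧ x.1.1 = c

/-- Two fixed arguments belong to the same part. -/
def Template.Same {R : Type u} {ar : R → ℕ} (T : Template ar) (x y : FixedArg T.comps) : Prop :=
  ∃ G ∈ T.parts, x ∈ G ∧ y ∈ G

/-- An instance of a template. -/
structure Template.Instance {R : Type u} {ar : R → ℕ} (T : Template ar) (O : Type v) where
  toFun : FixedArg T.comps → O
  eq_iff : ∀ x y, toFun x = toFun y ↔ T.Same x y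

/-- The instantiation `γ(T)`. -/
def Template.Instance.atoms {R : Type u} {ar : R → ℕ} {T : Template ar} {O : Type v}
    (γ : T.Instance O) : Set (Atom ar O) :=
  {A | ∃ (c : Component ar) (hc : c ∈ T.comps) (f : Fin (ar c.rel) → O),
    (∀ (i : Fin (ar c.rel)) (hi : (i : ℕ) ≠ c.pos), f i = γ.toFun ⟨(c, i), hc, i.2, hi⟩) ∧
    A = ⟨c.rel, f⟩}

/-- The weight `w(T, γ, s)`. -/
noncomputable def Template.Instance.weight {R : Type u} {ar : R → ℕ} {T : Template ar}
    {O : Type v} (γ : T.Instance O) (s : State ar O) : ℕ :=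
  (s ∩ γ.atoms).ncard

/-- At most one element of `Z` is true in any reachable state. -/
def IsMutexInvariantSet {R : Type u} {ar : R → ℕ} {O : Type v} (D : Domain ar) (P : Problem ar O)
    (Z : Set (Atom ar O)) : Prop :=
  ∀ s ∈ Reachable D P, (s ∩ Z).Subsingleton

def Template.IsInvariant {R : Type u} {ar : R → ℕ} {O : Type v} (T : Template ar)
    (D : Domain ar) (P : Problem ar O) : Prop :=
  ∀ γ : T.Instance O, IsMutexInvariantSet D P γ.atoms

/-! ### Matching literals and `T`-classes -/

/-- The literal `l` matches the template via the component `c`. -/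
def Literal.Matches {R : Type u} {ar : R → ℕ} {V : Type w} (l : Literal ar V)
    (c : Component ar) : Prop :=
  l.rel = c.rel ∧ (l.quantPos.Nonempty → l.quantPos = {c.pos})

/-- `T`-coupled literals. -/
def Template.Coupled {R : Type u} {ar : R → ℕ} {V : Type w} (T : Template ar)
    (l l' : Literal ar V) : Prop :=
  ∃ c ∈ T.comps, ∃ c' ∈ T.comps, l.Matches c ∧ l'.Matches c' ∧
    ∀ x y : FixedArg T.comps, x.1.1 = c → y.1.1 = c' → T.Same x y →
      l.argAt x.1.2 = l'.argAt y.1.2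

/-- `L` is a `T`-class of the set `M` of literals: the class, in `M`, of a literal of `M` that
matches the template. -/
def Template.IsClass {R : Type u} {ar : R → ℕ} {V : Type w} (T : Template ar)
    (M L : Finset (Literal ar V)) : Prop :=
  ∃ l₀ ∈ M, (∃ c ∈ T.comps, l₀.Matches c) ∧ ∀ l, l ∈ L ↔ l ∈ M ∧ T.Coupled l l₀

/-! ### Classification of (pure) schemas; `ω` is the number of objects -/

/-- The weight of a set of literals: a simple literal has weight `1`, a quantified one `ω`. -/
noncomputable def litWeight {R : Type u} {ar : R → ℕ} {V : Type w} (ω : ℕ)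
    (A : Finset (Literal ar V)) : ℕ :=
  open scoped Classical in ∑ l ∈ A, if l.quantPos.Nonempty then ω else 1

/-- The set `M` of literals covers every component of the template. -/
def Template.CoveredBy {R : Type u} {ar : R → ℕ} {V : Type w} (T : Template ar) (ω : ℕ)
    (M : Finset (Literal ar V)) : Prop :=
  ∀ c ∈ T.comps, (if c.pos = ar c.rel then 1 else ω) ≤
    litWeight ω (open scoped Classical in M.filter (fun l => l.Matches c))

def ActionSchema.Irrelevant {R : Type u} {ar : R → ℕ} {V : Type w} (ω : ℕ)
    (α : ActionSchema ar V) : Prop :=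
  litWeight ω α.prePos ≤ 1 ∧ litWeight ω α.addEff = 0

def ActionSchema.Relevant {R : Type u} {ar : R → ℕ} {V : Type w} (ω : ℕ)
    (α : ActionSchema ar V) : Prop :=
  litWeight ω α.prePos ≤ 1 ∧ litWeight ω α.addEff = 1

def ActionSchema.RelevantBalanced {R : Type u} {ar : R → ℕ} {V : Type w} (ω : ℕ)
    (α : ActionSchema ar V) : Prop :=
  α.Relevant ω ∧ litWeight ω α.prePos = 1 ∧ α.prePos ⊆ α.addEff ∪ α.delEff

def ActionSchema.RelevantUnbounded {R : Type u} {ar : R → ℕ} {V : Type w} (T : Template ar)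
    (ω : ℕ) (α : ActionSchema ar V) : Prop :=
  α.Relevant ω ∧ litWeight ω α.prePos = 0 ∧ ¬ T.CoveredBy ω α.literals

/-- Strong `γ`-safety of a ground action. -/
def GroundAction.StronglySafe {R : Type u} {ar : R → ℕ} {O : Type v} {T : Template ar}
    (a : GroundAction (Atom ar O)) (γ : T.Instance O) : Prop :=
  ∀ s, a.Applicable s → γ.weight s ≤ 1 → γ.weight (a.result s) ≤ 1

/-- Strong safety of a schema: all its groundings are strongly `γ`-safe for all instances. -/
def ActionSchema.StronglySafe {R : Type u} {ar : R → ℕ} {V : Type w} (T : Template ar)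
    (O : Type v) (α : ActionSchema ar V) : Prop :=
  ∀ (gr : V ↪ O) (γ : T.Instance O), (α.ground gr).StronglySafe γ

/-- Strong safety of the pure durative schema `Dα_L`: all its fragments are strongly safe. -/
def DurativeSchema.PureStronglySafe {R : Type u} {ar : R → ℕ} {V : Type w} (T : Template ar)
    (O : Type v) (δ : DurativeSchema ar V) (L : Finset (Literal ar V)) : Prop :=
  (δ.st.restrict L).StronglySafe T O ∧ (δ.inv.restrict L).StronglySafe T O ∧
    (δ.fin.restrict L).StronglySafe T O

/-- Executability of a sequence of two schemas: for every (common) grounding, there is a state in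
which the two ground actions can be executed one after the other. -/
def ExecutablePair {R : Type u} {ar : R → ℕ} {V : Type w} (O : Type v)
    (α β : ActionSchema ar V) : Prop :=
  ∀ gr : V ↪ O, ∃ s, (α.ground gr).Applicable s ∧ (β.ground gr).Applicable ((α.ground gr).result s)

/-- Reachability of a sequence of two pure schemas. -/
def ReachablePair {R : Type u} {ar : R → ℕ} {V : Type w} (O : Type v) [Fintype O]
    (α β : ActionSchema ar V) : Prop :=
  ExecutablePair O α β ∧
    litWeight (Fintype.card O) (α.prePos ∪ (β.prePos \ α.addEff)) ≤ 1

/-- The pure auxiliary durative schema `Dα_{*L}` is simply safe of type (a). -/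
structure DurativeSchema.SimplySafeTypeA {R : Type u} {ar : R → ℕ} {V : Type w} (T : Template ar)
    (O : Type v) [Fintype O] (δ : DurativeSchema ar V) (L : Finset (Literal ar V)) : Prop where
  reachable : ReachablePair O (δ.stAux.restrict L) (δ.finAux.restrict L)
  st_stronglySafe : (δ.stAux.restrict L).StronglySafe T O
  fin_unbounded : (δ.finAux.restrict L).RelevantUnbounded T (Fintype.card O)
  st_irrelevant : (δ.stAux.restrict L).Irrelevant (Fintype.card O)
  st_weight : litWeight (Fintype.card O) (δ.stAux.restrict L).prePos = 1
  st_consumes : (δ.stAux.restrict L).prePos ⊆ (δ.stAux.restrict L).delEff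

/-- Irrelevant or relevant balanced. -/
def ActionSchema.IrrelevantOrBalanced {R : Type u} {ar : R → ℕ} {V : Type w} (ω : ℕ)
    (α : ActionSchema ar V) : Prop :=
  α.Irrelevant ω ∨ α.RelevantBalanced ω

/-- Every add effect on a relation symbol of the template matches the template. -/
def Template.AddEffectsMatch {R : Type u} {ar : R → ℕ} {V : Type w} (T : Template ar)
    (α : ActionSchema ar V) : Prop :=
  ∀ l ∈ α.addEff, ∀ c ∈ T.comps, l.rel = c.rel → l.Matches c

end TemporalPlanning

/-! Fix an instance `γ` and let Z be its set of atoms. The literals that a grounding sends into Z,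
if there are any, form exactly one T-class (`isClass_literalsInto`), so the hypotheses on classes
become statements about ground actions relative to Z. An instantaneous action is `Balanced`. The
start and end of a durative action are both `Balanced`, or they form a `ConsumeProduce` pair: the
start deletes an atom of Z and the end puts back at most one.

The invariant `Plan.Safe` then says that there is at most one token: either a true atom of Z, or a
running pair that has taken the atom away. A consumer requires the token and affects it, so two
distinct consumers in one happening would interfere (`HappeningApplicable.consumer_unique`).
Whatever adds an atom of Z either consumes the token itself or is the end of a pair. Hence no
happening can duplicate the token (`Plan.Safe.step`), and induction along the trace concludes. -/

namespace TemporalPlanning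

universe u v w

/-! ### Weights and ground instances of literals; classes as preimages of an instance -/

section Literals

variable {R : Type u} {ar : R → ℕ} {V : Type w} {O : Type v}

open scoped Classical in
/-- The weight of a single literal. -/
noncomputable def Literal.weight (ω : ℕ) (l : Literal ar V) : ℕ :=
  if l.quantPos.Nonempty then ω else 1

theorem litWeight_eq_sum (ω : ℕ) (A : Finset (Literal ar V)) :
    litWeight ω A = ∑ l ∈ A, l.weight ω := rfl

theorem litWeight_mono (ω : ℕ) {A B : Finset (Literal ar V)} (h : A ⊆ B) :
    litWeight ω A ≤ litWeight ω B :=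
  Finset.sum_le_sum_of_subset h

theorem Literal.argAt_of_inl {l : Literal ar V} {i : ℕ} (hi : i < ar l.rel) {a : V}
    (h : l.arg ⟨i, hi⟩ = Sum.inl a) : l.argAt i = some (Sum.inl a) := by
  rw [Literal.argAt, dif_pos hi, h]
  rfl

theorem Literal.argAt_of_inr {l : Literal ar V} {i : ℕ} (hi : i < ar l.rel) {k : Fin (ar l.rel)}
    (h : l.arg ⟨i, hi⟩ = Sum.inr k) : l.argAt i = some (Sum.inr (k : ℕ)) := by
  rw [Literal.argAt, dif_pos hi, h]
  rfl

theorem Literal.mem_quantPos_of_arg {l : Literal ar V} {i k : Fin (ar l.rel)}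
    (h : l.arg i = Sum.inr k) : (i : ℕ) ∈ l.quantPos :=
  ⟨k, Literal.argAt_of_inr i.2 h⟩

/-- Weight zero forces a quantified literal over an empty set of objects. -/
theorem Literal.ground_eq_empty [Fintype O] {l : Literal ar V}
    (h : l.weight (Fintype.card O) = 0) (gr : V → O) : l.ground gr = ∅ := by
  rw [Literal.weight] at h
  split_ifs at h with hq
  obtain ⟨i, k, hk⟩ := hq
  rw [Set.eq_empty_iff_forall_notMem]
  rintro A ⟨σ, -⟩
  rw [Literal.argAt] at hk
  split_ifs at hk with hi
  exact (Fintype.card_eq_zero_iff.1 h).elim (σ ⟨i, hi⟩)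

theorem Literal.ground_nonempty [Fintype O] {l : Literal ar V}
    (h : l.weight (Fintype.card O) ≠ 0) (gr : V → O) : (l.ground gr).Nonempty := by
  suffices hσ : Nonempty (Fin (ar l.rel) → O) from ⟨_, hσ.some, rfl⟩
  rw [Literal.weight] at h
  split_ifs at h with hq
  · obtain ⟨o⟩ := Fintype.card_pos_iff.1 (Nat.pos_of_ne_zero h)
    exact ⟨fun _ => o⟩
  · refine ⟨fun i => ?_⟩
    match hi : l.arg i with
    | Sum.inl v => exact gr v
    | Sum.inr k => exact (hq ⟨i, Literal.mem_quantPos_of_arg hi⟩).elim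

/-- A quantified literal of weight at most one ranges over at most one object; a simple literal does
not depend on the substitution `σ`. -/
theorem Literal.ground_subsingleton [Fintype O] {l : Literal ar V}
    (h : l.weight (Fintype.card O) ≤ 1) (gr : V → O) : (l.ground gr).Subsingleton := by
  rintro A ⟨σ, rfl⟩ B ⟨τ, rfl⟩
  rw [Literal.weight] at h
  split_ifs at h with hq
  · have := Fintype.card_le_one_iff_subsingleton.1 h
    rw [Subsingleton.elim σ τ]
  · congr 1
    funext i
    match hi : l.arg i with
    | Sum.inl v => rfl
    | Sum.inr k => exact (hq ⟨i, Literal.mem_quantPos_of_arg hi⟩).elim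

theorem weight_eq_zero_of_litWeight_eq_zero {ω : ℕ} {A : Finset (Literal ar V)}
    (h : litWeight ω A = 0) {l : Literal ar V} (hl : l ∈ A) : l.weight ω = 0 :=
  Finset.sum_eq_zero_iff.1 h l hl

/-- A literal with a ground instance weighs at least one, so two different ones would already exceed
the bound. -/
theorem biUnion_ground_subsingleton [Fintype O] {A : Finset (Literal ar V)}
    (h : litWeight (Fintype.card O) A ≤ 1) (gr : V → O) :
    (⋃ l ∈ A, l.ground gr).Subsingleton := by
  have key : ∀ l ∈ A, ∀ X ∈ l.ground gr, l.weight (Fintype.card O) ≠ 0 := by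
    intro l _ X hX h0
    rw [Literal.ground_eq_empty h0] at hX
    exact hX
  intro X hX Y hY
  simp only [Set.mem_iUnion] at hX hY
  obtain ⟨l, hl, hX⟩ := hX
  obtain ⟨m, hm, hY⟩ := hY
  have h1 := key l hl X hX
  have h2 := key m hm Y hY
  have hlm : l = m := by
    by_contra hne
    have h3 := litWeight_mono (Fintype.card O)
      (Finset.insert_subset hl (Finset.singleton_subset_iff.2 hm))
    rw [litWeight_eq_sum, Finset.sum_pair hne] at h3
    omega
  subst hlm
  refine Literal.ground_subsingleton (le_trans ?_ h) gr hX hY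
  have h3 := litWeight_mono (Fintype.card O) (Finset.singleton_subset_iff.2 hl)
  rwa [litWeight_eq_sum, Finset.sum_singleton] at h3

theorem exists_weight_ne_zero {ω : ℕ} {A : Finset (Literal ar V)} (h : litWeight ω A ≠ 0) :
    ∃ l ∈ A, l.weight ω ≠ 0 :=
  Finset.exists_ne_zero_of_sum_ne_zero h

/-- The literal `l` matches the template, and its free arguments are sent by `gr` to the objects
prescribed by the instance `γ`. -/
def Literal.GroundsInto {T : Template ar} (l : Literal ar V) (gr : V → O)
    (γ : T.Instance O) : Prop :=
  ∃ c ∈ T.comps, l.Matches c ∧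
    ∀ x : FixedArg T.comps, x.1.1 = c → ∃ a, l.argAt x.1.2 = some (Sum.inl a) ∧ gr a = γ.toFun x

theorem Literal.GroundsInto.ground_subset {T : Template ar} {l : Literal ar V} {gr : V → O}
    {γ : T.Instance O} (h : l.GroundsInto gr γ) : l.ground gr ⊆ γ.atoms := by
  obtain ⟨c, hc, ⟨hrel, -⟩, hx⟩ := h
  rintro A ⟨σ, rfl⟩
  obtain ⟨r, arg, can⟩ := l
  dsimp only at hrel
  subst hrel
  refine ⟨c, hc, _, fun i hi => ?_, rfl⟩
  obtain ⟨a, ha, hga⟩ := hx ⟨(c, i), hc, i.2, hi⟩ rfl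
  rw [← hga]
  match hi : arg i with
  | Sum.inl b =>
    rw [Literal.argAt_of_inl i.2 hi, Option.some.injEq, Sum.inl.injEq] at ha
    rw [← ha]
    simp only [hi, Sum.elim_inl]
  | Sum.inr k =>
    rw [Literal.argAt_of_inr i.2 hi, Option.some.injEq] at ha
    exact (Sum.inr_ne_inl ha).elim

/-- Matching confines quantification to the counted position. Every fixed position therefore carries
a free argument, and its value can be read off a single common atom. -/
theorem Literal.groundsInto_of_mem {T : Template ar} {l : Literal ar V} {gr : V → O}
    {γ : T.Instance O} (hl : ∀ c ∈ T.comps, l.rel = c.rel → l.Matches c) {A : Atom ar O}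
    (hA : A ∈ l.ground gr) (hγ : A ∈ γ.atoms) : l.GroundsInto gr γ := by
  obtain ⟨σ, rfl⟩ := hA
  obtain ⟨c, hc, f, hf, hAf⟩ := hγ
  have hm := hl c hc (congrArg Atom.rel hAf)
  refine ⟨c, hc, hm, ?_⟩
  have hq : ∀ i ∈ l.quantPos, i = c.pos := fun i hi => by
    have := hm.2 ⟨i, hi⟩
    rwa [this] at hi
  clear hm hl
  obtain ⟨r, arg, can⟩ := l
  rw [Atom.mk.injEq] at hAf
  obtain ⟨hr, hAf⟩ := hAf
  dsimp only at hr
  subst hr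
  rw [heq_eq_eq] at hAf
  rintro ⟨⟨c', i⟩, hc', hi, hip⟩ hcc
  dsimp only at hcc hi hip ⊢
  subst hcc
  match ha : arg ⟨i, hi⟩ with
  | Sum.inl a =>
    refine ⟨a, Literal.argAt_of_inl hi ha, ?_⟩
    rw [← hf ⟨i, hi⟩ hip, ← hAf]
    simp only [ha, Sum.elim_inl]
  | Sum.inr k =>
    exact (hip (hq i ⟨k, Literal.argAt_of_inr hi ha⟩)).elim

open scoped Classical in
/-- The literals of `M` that are grounded by `gr` into `γ(T)`. -/
noncomputable def literalsInto {T : Template ar} (M : Finset (Literal ar V)) (gr : V → O)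
    (γ : T.Instance O) : Finset (Literal ar V) :=
  M.filter (fun l => l.GroundsInto gr γ)

theorem mem_literalsInto {T : Template ar} {M : Finset (Literal ar V)} {gr : V → O}
    {γ : T.Instance O} {l : Literal ar V} :
    l ∈ literalsInto M gr γ ↔ l ∈ M ∧ l.GroundsInto gr γ := by
  classical
  exact Finset.mem_filter

/-- The bridge from schemas to ground actions. Both `gr` and `γ` are injective, `γ` modulo the
partition, so being sent into the same instance is the same as having equal arguments at equivalent
positions. -/
theorem isClass_literalsInto {T : Template ar}
    (hrel : ∀ c ∈ T.comps, ∀ c' ∈ T.comps, c.rel = c'.rel → c = c')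
    {M : Finset (Literal ar V)} (gr : V ↪ O) (γ : T.Instance O)
    (hne : (literalsInto M gr γ).Nonempty) : T.IsClass M (literalsInto M gr γ) := by
  obtain ⟨l₀, hl₀⟩ := hne
  obtain ⟨hM, c₀, hc₀, hm₀, hx₀⟩ := mem_literalsInto.1 hl₀
  refine ⟨l₀, hM, ⟨c₀, hc₀, hm₀⟩, fun l => ?_⟩
  rw [mem_literalsInto, and_congr_right_iff]
  intro _
  constructor
  · rintro ⟨c, hc, hm, hx⟩
    refine ⟨c, hc, c₀, hc₀, hm, hm₀, fun x y hxc hyc hxy => ?_⟩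
    obtain ⟨a, ha, hga⟩ := hx x hxc
    obtain ⟨b, hb, hgb⟩ := hx₀ y hyc
    rw [ha, hb, gr.injective (hga.trans (((γ.eq_iff x y).2 hxy).trans hgb.symm))]
  · rintro ⟨c, hc, c', hc', hm, hm', hcp⟩
    -- The coupling might a priori use another component for `l₀`; the relation symbol determines
    -- it.
    obtain rfl := hrel c' hc' c₀ hc₀ (hm'.1.symm.trans hm₀.1)
    refine ⟨c, hc, hm, fun x hxc => ?_⟩
    obtain ⟨G, ⟨hG, hxG⟩, -⟩ := T.isPartition.2 x
    -- Admissibility gives each fixed argument of `c` a partner in the component of `l₀`, where the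
    -- value is known.
    obtain ⟨y, ⟨hyG, hyc⟩, -⟩ := T.admissible G hG c' hc'
    have hxy : T.Same x y := ⟨G, hG, hxG, hyG⟩
    obtain ⟨a, ha, hga⟩ := hx₀ y hyc
    exact ⟨a, (hcp x y hxc hyc hxy).trans ha, hga.trans ((γ.eq_iff x y).2 hxy).symm⟩

end Literals

/-! ### Consumers of an atom set within one happening -/

section GroundActions

variable {Λ : Type*}

/-- `a` requires and affects an element of `Z`. -/
def GroundAction.Consumes (a : GroundAction Λ) (Z : Set Λ) : Prop :=
  ∃ q ∈ Z, q ∈ a.prePos ∧ q ∈ a.addEff ∪ a.delEff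

/-- `a` adds no element of `Z`, or it adds at most one while it consumes one. -/
def GroundAction.Balanced (a : GroundAction Λ) (Z : Set Λ) : Prop :=
  a.addEff ∩ Z = ∅ ∨ a.Consumes Z ∧ (a.addEff ∩ Z).Subsingleton

/-- `a` consumes an element of `Z` and `b` gives back at most one. -/
structure GroundAction.ConsumeProduce (a b : GroundAction Λ) (Z : Set Λ) : Prop where
  consumes : a.Consumes Z
  addEff_inter : a.addEff ∩ Z = ∅
  subsingleton : (b.addEff ∩ Z).Subsingleton

theorem GroundAction.Consumes.inter_nonempty {a : GroundAction Λ} {Z s : Set Λ}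
    (h : a.Consumes Z) (ha : a.Applicable s) : (s ∩ Z).Nonempty := by
  obtain ⟨q, hZ, hq, -⟩ := h
  exact ⟨q, ha.1 hq, hZ⟩

/-- Both would require and affect the one true atom of `Z`, against non-interference. -/
theorem HappeningApplicable.consumer_unique {I : Type*} {A : Set (I × GroundAction Λ)}
    {Z s : Set Λ} (hA : HappeningApplicable A s) (hs : (s ∩ Z).Subsingleton)
    {x y : I × GroundAction Λ} (hx : x ∈ A) (hy : y ∈ A) (hxZ : x.2.Consumes Z)
    (hyZ : y.2.Consumes Z) : x = y := by
  by_contra hne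
  obtain ⟨q, hq, hqx, -⟩ := hxZ
  obtain ⟨p, hp, hpy, hpe⟩ := hyZ
  obtain rfl := hs ⟨(hA.1 x hx).1 hqx, hq⟩ ⟨(hA.1 y hy).1 hpy, hp⟩
  exact Set.eq_empty_iff_forall_notMem.1 (hA.2 hx hy hne).1 q ⟨Or.inl hqx, hpe⟩

/-- The only old atom of `Z` is the consumed one, and the consumer either deletes it or adds it
again. -/
theorem HappeningApplicable.mem_addEff_of_consumes {I : Type*} {A : Set (I × GroundAction Λ)}
    {Z s : Set Λ} (hA : HappeningApplicable A s) (hs : (s ∩ Z).Subsingleton)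
    {x : I × GroundAction Λ} (hx : x ∈ A) (hxZ : x.2.Consumes Z) {q : Λ}
    (hq : q ∈ happeningResult A s ∩ Z) : ∃ y ∈ A, q ∈ y.2.addEff := by
  obtain ⟨⟨hqs, hqd⟩ | hqa, hqZ⟩ := hq
  · obtain ⟨p, hp, hpx, hpe⟩ := hxZ
    obtain rfl := hs ⟨hqs, hqZ⟩ ⟨(hA.1 x hx).1 hpx, hp⟩
    exact hpe.elim (fun h => ⟨x, hx, h⟩) fun h => (hqd (Set.mem_biUnion hx h)).elim
  · simpa using hqa

end GroundActions

/-! ### From pure schemas to balanced ground actions -/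

section Schemas

variable {R : Type u} {ar : R → ℕ} {V : Type w} {O : Type v} {T : Template ar}

/-- `M` may exceed the literals of `α`, because the classes of a fragment are taken among the
literals of the whole durative schema. -/
theorem ActionSchema.addEff_ground_inter_subset {α : ActionSchema ar V}
    (hα : T.AddEffectsMatch α) {M : Finset (Literal ar V)} (hM : α.addEff ⊆ M) (gr : V ↪ O)
    (γ : T.Instance O) :
    (α.ground gr).addEff ∩ γ.atoms ⊆
      ⋃ l ∈ (α.restrict (literalsInto M gr γ)).addEff, l.ground gr := by
  rintro A ⟨hA, hγ⟩
  simp only [ActionSchema.ground, Set.mem_iUnion] at hA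
  obtain ⟨l, hl, hA⟩ := hA
  refine Set.mem_biUnion (Finset.mem_inter.2 ⟨hl, mem_literalsInto.2 ⟨hM hl, ?_⟩⟩) hA
  exact Literal.groundsInto_of_mem (hα l hl) hA hγ

theorem ActionSchema.addEff_ground_inter_eq_empty [Fintype O] {α : ActionSchema ar V}
    (hα : T.AddEffectsMatch α) {M : Finset (Literal ar V)} (hM : α.addEff ⊆ M) (gr : V ↪ O)
    (γ : T.Instance O)
    (h : litWeight (Fintype.card O) (α.restrict (literalsInto M gr γ)).addEff = 0) :
    (α.ground gr).addEff ∩ γ.atoms = ∅ := by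
  refine Set.subset_empty_iff.1 ((addEff_ground_inter_subset hα hM gr γ).trans ?_)
  refine Set.iUnion₂_subset fun l hl => ?_
  rw [Literal.ground_eq_empty (weight_eq_zero_of_litWeight_eq_zero h hl)]

theorem ActionSchema.addEff_ground_inter_subsingleton [Fintype O] {α : ActionSchema ar V}
    (hα : T.AddEffectsMatch α) {M : Finset (Literal ar V)} (hM : α.addEff ⊆ M) (gr : V ↪ O)
    (γ : T.Instance O)
    (h : litWeight (Fintype.card O) (α.restrict (literalsInto M gr γ)).addEff = 1) :
    ((α.ground gr).addEff ∩ γ.atoms).Subsingleton :=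
  (biUnion_ground_subsingleton h.le gr).anti (addEff_ground_inter_subset hα hM gr γ)

theorem ActionSchema.ground_consumes [Fintype O] {α : ActionSchema ar V} {gr : V ↪ O}
    {γ : T.Instance O} {l : Literal ar V} (hw : l.weight (Fintype.card O) ≠ 0)
    (hl : l.GroundsInto gr γ) (hpre : l ∈ α.prePos) (heff : l ∈ α.addEff ∪ α.delEff) :
    (α.ground gr).Consumes γ.atoms := by
  obtain ⟨q, hq⟩ := Literal.ground_nonempty hw gr
  exact ⟨q, hl.ground_subset hq, Set.mem_biUnion hpre hq,
    (Finset.mem_union.1 heff).imp (Set.mem_biUnion · hq) (Set.mem_biUnion · hq)⟩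

theorem ActionSchema.ground_balanced_of_irrelevantOrBalanced [Fintype O] {α : ActionSchema ar V}
    (hα : T.AddEffectsMatch α) {M : Finset (Literal ar V)} (hM : α.addEff ⊆ M) (gr : V ↪ O)
    (γ : T.Instance O)
    (h : (α.restrict (literalsInto M gr γ)).IrrelevantOrBalanced (Fintype.card O)) :
    (α.ground gr).Balanced γ.atoms := by
  rcases h with h | h
  · exact Or.inl (addEff_ground_inter_eq_empty hα hM gr γ h.2)
  · refine Or.inr ⟨?_, addEff_ground_inter_subsingleton hα hM gr γ h.1.2⟩
    -- Nonzero weight ensures that the required literal has a ground instance, which serves as the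
    -- consumed atom.
    obtain ⟨l, hl, hw⟩ := exists_weight_ne_zero (h.2.1.trans_ne one_ne_zero)
    have heff := h.2.2 hl
    simp only [ActionSchema.restrict, Finset.mem_inter, Finset.mem_union] at hl heff
    exact ground_consumes hw (mem_literalsInto.1 hl.2).2 hl.1
      (Finset.mem_union.2 (heff.imp And.left And.left))

theorem ActionSchema.ground_balanced_of_eq_empty {α : ActionSchema ar V}
    (hα : T.AddEffectsMatch α) {M : Finset (Literal ar V)} (hM : α.addEff ⊆ M) (gr : V ↪ O)
    (γ : T.Instance O) (h : literalsInto M gr γ = ∅) : (α.ground gr).Balanced γ.atoms := by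
  left
  have := addEff_ground_inter_subset hα hM gr γ
  simpa [h, ActionSchema.restrict] using this

theorem ActionSchema.ground_balanced [Fintype O] {α : ActionSchema ar V}
    (hrel : ∀ c ∈ T.comps, ∀ c' ∈ T.comps, c.rel = c'.rel → c = c')
    (hα : T.AddEffectsMatch α)
    (h : ∀ L, T.IsClass α.literals L → (α.restrict L).IrrelevantOrBalanced (Fintype.card O))
    (gr : V ↪ O) (γ : T.Instance O) : (α.ground gr).Balanced γ.atoms := by
  have hM : α.addEff ⊆ α.literals := fun l hl => by simp [ActionSchema.literals, hl]
  rcases (literalsInto α.literals gr γ).eq_empty_or_nonempty with he | hne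
  · exact ground_balanced_of_eq_empty hα hM gr γ he
  · exact ground_balanced_of_irrelevantOrBalanced hα hM gr γ
      (h _ (isClass_literalsInto hrel gr γ hne))

theorem DurativeSchema.SimplySafeTypeA.consumeProduce [Fintype O] {δ : DurativeSchema ar V}
    (hst : T.AddEffectsMatch δ.st) (hfin : T.AddEffectsMatch δ.fin) (gr : V ↪ O)
    (γ : T.Instance O)
    (h : δ.SimplySafeTypeA T O (literalsInto δ.literals gr γ)) :
    (δ.st.ground gr).ConsumeProduce (δ.fin.ground gr) γ.atoms where
  consumes := by
    obtain ⟨l, hl, hw⟩ := exists_weight_ne_zero (h.st_weight.trans_ne one_ne_zero)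
    have hdel := h.st_consumes hl
    simp only [ActionSchema.restrict, DurativeSchema.stAux, Finset.mem_inter, Finset.mem_union,
      Finset.mem_sdiff] at hl hdel
    refine ActionSchema.ground_consumes hw (mem_literalsInto.1 hl.2).2 (hl.1.resolve_right ?_)
      (Finset.mem_union_right _ hdel.1)
    -- A literal inherited from the overall conditions would also be a precondition of the auxiliary
    -- end, whose positive preconditions in the class weigh zero. So the real start requires it.
    rintro ⟨hinv, -⟩
    refine hw (weight_eq_zero_of_litWeight_eq_zero h.fin_unbounded.2.1 ?_)
    simp only [ActionSchema.restrict, DurativeSchema.finAux, Finset.mem_inter, Finset.mem_union]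
    exact ⟨Or.inr hinv, hl.2⟩
  addEff_inter := ActionSchema.addEff_ground_inter_eq_empty hst
    (fun l hl => by simp [DurativeSchema.literals, ActionSchema.literals, hl]) gr γ
    h.st_irrelevant.2
  subsingleton := ActionSchema.addEff_ground_inter_subsingleton hfin
    (fun l hl => by simp [DurativeSchema.literals, ActionSchema.literals, hl]) gr γ
    h.fin_unbounded.1.2

/-- For a fixed grounding and instance only one class matters, so its strong safety decides the
alternative for start and end together. -/
theorem DurativeSchema.ground_balanced_or_consumeProduce [Fintype O] {δ : DurativeSchema ar V}
    (hrel : ∀ c ∈ T.comps, ∀ c' ∈ T.comps, c.rel = c'.rel → c = c')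
    (hst : T.AddEffectsMatch δ.st) (hfin : T.AddEffectsMatch δ.fin)
    (h₁ : ∀ L, T.IsClass δ.literals L → ¬ δ.PureStronglySafe T O L → δ.SimplySafeTypeA T O L)
    (h₂ : ∀ L, T.IsClass δ.literals L → δ.PureStronglySafe T O L →
      (δ.st.restrict L).IrrelevantOrBalanced (Fintype.card O) ∧
      (δ.fin.restrict L).IrrelevantOrBalanced (Fintype.card O))
    (gr : V ↪ O) (γ : T.Instance O) :
    (δ.st.ground gr).Balanced γ.atoms ∧ (δ.fin.ground gr).Balanced γ.atoms ∨
      (δ.st.ground gr).ConsumeProduce (δ.fin.ground gr) γ.atoms := by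
  have hM₁ : δ.st.addEff ⊆ δ.literals := fun l hl => by
    simp [DurativeSchema.literals, ActionSchema.literals, hl]
  have hM₂ : δ.fin.addEff ⊆ δ.literals := fun l hl => by
    simp [DurativeSchema.literals, ActionSchema.literals, hl]
  rcases (literalsInto δ.literals gr γ).eq_empty_or_nonempty with he | hne
  · exact Or.inl ⟨ActionSchema.ground_balanced_of_eq_empty hst hM₁ gr γ he,
      ActionSchema.ground_balanced_of_eq_empty hfin hM₂ gr γ he⟩
  have hL := isClass_literalsInto hrel gr γ hne
  by_cases hs : δ.PureStronglySafe T O (literalsInto δ.literals gr γ)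
  · have := h₂ _ hL hs
    exact Or.inl
      ⟨ActionSchema.ground_balanced_of_irrelevantOrBalanced hst hM₁ gr γ this.1,
        ActionSchema.ground_balanced_of_irrelevantOrBalanced hfin hM₂ gr γ this.2⟩
  · exact Or.inr ((h₁ _ hL hs).consumeProduce hst hfin gr γ)

end Schemas

/-! ### The token invariant along a trace -/

section Plans

variable {R : Type u} {ar : R → ℕ} {O : Type v} {D : Domain ar} {P : Problem ar O}

/-- The `j`-th action of the plan is durative, lasts from `x` to `y`, and its start consumes an
element of `Z` while its end gives back at most one. -/
def Plan.Holds (π : Plan D P) (Z : Set (Atom ar O)) (j : Fin π.n) (x y : ℚ) : Prop :=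
  ∃ d gr len, π.act j = .dur x d gr len ∧ y = x + len ∧
    ((D.dur d).st.ground gr).ConsumeProduce ((D.dur d).fin.ground gr) Z

/-- At most one element of `Z` is true in the state `s` at time `t`, and none while some durative
action holds it back; at most one action does so. -/
structure Plan.Safe (π : Plan D P) (Z : Set (Atom ar O)) (t : ℚ) (s : State ar O) : Prop where
  subsingleton : (s ∩ Z).Subsingleton
  empty : ∀ j x y, π.Holds Z j x y → x ≤ t → t < y → s ∩ Z = ∅
  unique : ∀ j x y j' x' y', π.Holds Z j x y → x ≤ t → t < y → π.Holds Z j' x' y' → x' ≤ t →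
    t < y' → j = j'

theorem Plan.Induced.unique {π : Plan D P} {j : Fin π.n} {r : Role} {τ : ℚ}
    {a b : GroundAction (Atom ar O)} (ha : π.Induced j r τ a) (hb : π.Induced j r τ b) :
    a = b := by
  cases ha <;> cases hb <;> simp_all <;> aesop

theorem Plan.Holds.le {π : Plan D P} {Z : Set (Atom ar O)} {j : Fin π.n} {x y : ℚ}
    (h : π.Holds Z j x y) : x ≤ y := by
  obtain ⟨d, gr, len, hj, rfl, -⟩ := h
  have := π.length_nonneg j
  rw [hj] at this
  exact le_add_of_nonneg_right this

theorem Plan.Holds.lt {π : Plan D P} {Z : Set (Atom ar O)} {j : Fin π.n} {x y : ℚ}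
    (h : π.Holds Z j x y) : P.t₀ < x := by
  obtain ⟨d, gr, len, hj, rfl, -⟩ := h
  have := π.time_pos j
  rwa [hj] at this

theorem Plan.Holds.end_unique {π : Plan D P} {Z : Set (Atom ar O)} {j : Fin π.n} {x y x' y' : ℚ}
    (h : π.Holds Z j x y) (h' : π.Holds Z j x' y') : y = y' := by
  obtain ⟨d, gr, len, hj, rfl, -⟩ := h
  obtain ⟨d', gr', len', hj', rfl, -⟩ := h'
  rw [hj, TimedAction.dur.injEq] at hj'
  rw [hj'.1, hj'.2.2.2]

theorem Plan.Holds.exists_start {π : Plan D P} {Z : Set (Atom ar O)} {j : Fin π.n} {x y : ℚ}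
    (h : π.Holds Z j x y) :
    ∃ a, π.Induced j .st x a ∧ a.Consumes Z ∧ a.addEff ∩ Z = ∅ := by
  obtain ⟨d, gr, len, hj, rfl, hc⟩ := h
  exact ⟨_, .st j x d gr len x hj rfl, hc.consumes, hc.addEff_inter⟩

/-- The start of a consuming pair is itself balanced, since it adds nothing in `Z`; only the end of
such a pair can add without consuming. -/
theorem Plan.Induced.balanced_or_end {π : Plan D P} {Z : Set (Atom ar O)}
    (hI : ∀ i gr, ((D.inst i).ground gr).Balanced Z)
    (hD : ∀ d gr, (((D.dur d).st.ground gr).Balanced Z ∧ ((D.dur d).fin.ground gr).Balanced Z) ∨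
      ((D.dur d).st.ground gr).ConsumeProduce ((D.dur d).fin.ground gr) Z)
    {j : Fin π.n} {r : Role} {τ : ℚ} {a : GroundAction (Atom ar O)} (h : π.Induced j r τ a) :
    a.Balanced Z ∨ r = .fin ∧ (∃ x, π.Holds Z j x τ) ∧ (a.addEff ∩ Z).Subsingleton := by
  cases h with
  | whole t i gr _ hj hτ => exact Or.inl (hI i gr)
  | st t d gr len _ hj hτ =>
    exact Or.inl ((hD d gr).elim And.left fun h => Or.inl h.addEff_inter)
  | fin t d gr len _ hj hτ =>
    exact (hD d gr).imp And.right fun h => ⟨rfl, ⟨t, d, gr, len, hj, hτ, h⟩, h.subsingleton⟩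
  | inv t d gr len x y _ hj =>
    left
    left
    simp [ActionSchema.ground, (D.dur d).inv_addEff]

/-- Safety is preserved by the next happening. -/
theorem Plan.Safe.step {π : Plan D P} {Z : Set (Atom ar O)}
    (hI : ∀ i gr, ((D.inst i).ground gr).Balanced Z)
    (hD : ∀ d gr, (((D.dur d).st.ground gr).Balanced Z ∧ ((D.dur d).fin.ground gr).Balanced Z) ∨
      ((D.dur d).st.ground gr).ConsumeProduce ((D.dur d).fin.ground gr) Z)
    {t t' : ℚ} {s : State ar O} (hs : π.Safe Z t s) (htt : t < t')
    (hgap : ∀ j r τ a, π.Induced j r τ a → τ ≤ t ∨ t' ≤ τ)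
    (hA : HappeningApplicable (π.induced.happening t') s) :
    π.Safe Z t' (happeningResult (π.induced.happening t') s) := by
  -- an action that holds back at `t'` either held back before, or starts at `t'`
  have hopen : ∀ k x y, π.Holds Z k x y → x ≤ t' → t' ≤ y → x ≤ t ∧ t < y ∧ s ∩ Z = ∅ ∨
      ∃ a, ((k, Role.st), a) ∈ π.induced.happening t' ∧ a.Consumes Z ∧ a.addEff ∩ Z = ∅ := by
    intro k x y h hx hy
    obtain ⟨a, ha, hc, he⟩ := h.exists_start
    rcases hgap _ _ _ _ ha with hxt | hxt
    · have hty := htt.trans_le hy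
      exact Or.inl ⟨hxt, hty, hs.empty k x y h hxt hty⟩
    · obtain rfl := le_antisymm hx hxt
      exact Or.inr ⟨a, ha, hc, he⟩
  have hcons : ∀ e ∈ π.induced.happening t', e.2.Consumes Z → s ∩ Z ≠ ∅ := fun e he h =>
    (h.inter_nonempty (hA.1 e he)).ne_empty
  -- Closed intervals also cover actions that end at `t'`, including those of length zero. A running
  -- pair leaves no atom for a new consumer, and two new starts would be two consumers.
  have huniq : ∀ k x y k' x' y', π.Holds Z k x y → x ≤ t' → t' ≤ y → π.Holds Z k' x' y' →
      x' ≤ t' → t' ≤ y' → k = k' := by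
    intro k x y k' x' y' h hx hy h' hx' hy'
    rcases hopen k x y h hx hy with ⟨h1, h2, h3⟩ | ⟨a, ha, hc, -⟩ <;>
    rcases hopen k' x' y' h' hx' hy' with ⟨h1', h2', h3'⟩ | ⟨a', ha', hc', -⟩
    · exact hs.unique k x y k' x' y' h h1 h2 h' h1' h2'
    · exact (hcons _ ha' hc' h3).elim
    · exact (hcons _ ha hc h3').elim
    · have := hA.consumer_unique hs.subsingleton ha ha' hc hc'
      simp only [Prod.mk.injEq] at this
      exact this.1.1
  by_cases H : ∃ k x y, π.Holds Z k x y ∧ x ≤ t' ∧ t' ≤ y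
  · obtain ⟨k, x, y, h, hx, hy⟩ := H
    -- No old atom of `Z` survives unless it is added anew, and no other action can consume the
    -- token; the only possible source is the end of `k`.
    have hadd : ∀ q ∈ happeningResult (π.induced.happening t') s ∩ Z,
        ∃ a, π.Induced k .fin t' a ∧ q ∈ a.addEff ∩ Z ∧ (a.addEff ∩ Z).Subsingleton ∧
          ∃ x', π.Holds Z k x' t' := by
      intro q hq
      have hex : ∃ e ∈ π.induced.happening t', q ∈ e.2.addEff := by
        rcases hopen k x y h hx hy with ⟨-, -, h3⟩ | ⟨a, ha, hc, -⟩
        · rcases hq with ⟨hqs | hqa, hqZ⟩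
          · exact (Set.eq_empty_iff_forall_notMem.1 h3 q ⟨hqs.1, hqZ⟩).elim
          · simpa using hqa
        · exact hA.mem_addEff_of_consumes hs.subsingleton ha hc hq
      obtain ⟨⟨⟨j, r⟩, a⟩, he, hqe⟩ := hex
      have hqa : q ∈ a.addEff ∩ Z := ⟨hqe, hq.2⟩
      have he' : π.Induced j r t' a := he
      rcases he'.balanced_or_end hI hD with (hb | ⟨hb, -⟩) | ⟨rfl, ⟨x', hx'⟩, hsub⟩
      · rw [hb] at hqa
        exact hqa.elim
      · rcases hopen k x y h hx hy with ⟨-, -, h3⟩ | ⟨a', ha', hc', he'⟩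
        · exact (hcons _ he hb h3).elim
        · have := hA.consumer_unique hs.subsingleton he ha' hb hc'
          obtain rfl : a = a' := (Prod.ext_iff.1 this).2
          rw [he'] at hqa
          exact hqa.elim
      · obtain rfl := huniq k x y j x' t' h hx hy hx' hx'.le le_rfl
        exact ⟨a, he', hqa, hsub, x', hx'⟩
    refine ⟨fun p hp q hq => ?_, fun j x' y' h' hx' hy' => ?_,
      fun j x₁ y₁ j' x₂ y₂ h₁ h₂ h₃ h₄ h₅ h₆ => huniq _ _ _ _ _ _ h₁ h₂ h₃.le h₄ h₅ h₆.le⟩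
    · obtain ⟨a, ha, hpa, hsub, -⟩ := hadd p hp
      obtain ⟨b, hb, hqb, -⟩ := hadd q hq
      obtain rfl := ha.unique hb
      exact hsub hpa hqb
    · refine Set.eq_empty_iff_forall_notMem.2 fun q hq => ?_
      obtain ⟨a, -, -, -, x'', h''⟩ := hadd q hq
      obtain rfl := huniq _ _ _ _ _ _ h' hx' hy'.le h hx hy
      -- An atom can only come from the end of the action at `t'`, but the action is still running
      -- then.
      exact hy'.ne (h''.end_unique h')
  · refine ⟨?_, fun j x y h hx hy => (H ⟨j, x, y, h, hx, hy.le⟩).elim,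
      fun j x y _ _ _ h hx hy _ _ _ => (H ⟨j, x, y, h, hx, hy.le⟩).elim⟩
    -- With no pair running or ending at `t'`, whatever adds an atom of `Z` must be a balanced
    -- consumer, of which there is at most one.
    have hadd : ∀ e ∈ π.induced.happening t', ∀ q ∈ e.2.addEff ∩ Z,
        e.2.Consumes Z ∧ (e.2.addEff ∩ Z).Subsingleton := by
      rintro ⟨⟨j, r⟩, a⟩ he q hq
      have he' : π.Induced j r t' a := he
      rcases he'.balanced_or_end hI hD with (hb | hb) | ⟨-, ⟨x, hx⟩, -⟩
      · rw [hb] at hq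
        exact hq.elim
      · exact hb
      · exact (H ⟨j, x, t', hx, hx.le, le_rfl⟩).elim
    by_cases hc : ∃ e ∈ π.induced.happening t', e.2.Consumes Z
    · obtain ⟨e, he, hc⟩ := hc
      intro p hp q hq
      obtain ⟨f, hf, hpf⟩ := hA.mem_addEff_of_consumes hs.subsingleton he hc hp
      obtain ⟨g, hg, hqg⟩ := hA.mem_addEff_of_consumes hs.subsingleton he hc hq
      obtain ⟨hfc, hsub⟩ := hadd f hf p ⟨hpf, hp.2⟩
      obtain ⟨hgc, -⟩ := hadd g hg q ⟨hqg, hq.2⟩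
      obtain rfl := hA.consumer_unique hs.subsingleton hf hg hfc hgc
      exact hsub ⟨hpf, hp.2⟩ ⟨hqg, hq.2⟩
    · refine hs.subsingleton.anti ?_
      rintro q ⟨hq | hq, hqZ⟩
      · exact ⟨hq.1, hqZ⟩
      · simp only [Set.mem_iUnion] at hq
        obtain ⟨e, he, hq⟩ := hq
        exact (hc ⟨e, he, (hadd e he q ⟨hq, hqZ⟩).1⟩).elim

theorem isMutexInvariantSet_of_balanced {Z : Set (Atom ar O)} (hinit : (P.init ∩ Z).Subsingleton)
    (hI : ∀ i gr, ((D.inst i).ground gr).Balanced Z)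
    (hD : ∀ d gr, (((D.dur d).st.ground gr).Balanced Z ∧ ((D.dur d).fin.ground gr).Balanced Z) ∨
      ((D.dur d).st.ground gr).ConsumeProduce ((D.dur d).fin.ground gr) Z) :
    IsMutexInvariantSet D P Z := by
  rintro s ⟨π, k, t, S, hT, -, i, rfl⟩
  suffices h : π.Safe Z (t i) (S i) from h.subsingleton
  induction i using Fin.induction with
  | zero =>
    rw [hT.time_zero, hT.state_zero]
    -- All actions start strictly after the initial time, so none is running yet.
    exact ⟨hinit, fun j x y h hx => (h.lt.not_ge hx).elim,
      fun j x y _ _ _ h hx => (h.lt.not_ge hx).elim⟩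
  | succ i ih =>
    rw [hT.state_succ i]
    refine ih.step hI hD (hT.strictMono Fin.castSucc_lt_succ) (fun j r τ a h => ?_)
      (hT.applicable i)
    -- Every occurrence time belongs to the trace, so nothing happens strictly between consecutive
    -- trace times.
    have hτ : τ ∈ Set.range t := by
      rw [hT.range_eq]
      exact Or.inr ⟨((j, r), a), h⟩
    obtain ⟨m, rfl⟩ := hτ
    rw [hT.strictMono.le_iff_le, hT.strictMono.le_iff_le]
    exact (le_or_gt m i.castSucc).imp_right Fin.castSucc_lt_iff_succ_le.1

end Plans

theorem atom_finite {R : Type u} (ar : R → ℕ) (O : Type v) [Finite R] [Finite O] : Finite (Atom ar O) :=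
  Finite.of_injective (β := Σ r : R, Fin (ar r) → O) (fun A => ⟨A.rel, A.args⟩) fun A B h => by
    cases A
    cases B
    simpa using h

end TemporalPlanning

theorem mainTheorem6 {R : Type*} [Finite R] (ar : R → ℕ) {O : Type*} [Fintype O]
    (D : TemporalPlanning.Domain ar) (P : TemporalPlanning.Problem ar O)
    (T : TemporalPlanning.Template ar)
    -- distinct components have distinct relation symbols
    (hrel : ∀ c ∈ T.comps, ∀ c' ∈ T.comps, c.rel = c'.rel → c = c')
    -- add effects on relation symbols of the template match the template
    (hinst : ∀ i : D.Inst, T.AddEffectsMatch (D.inst i))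
    (hdur : ∀ d : D.Dur, T.AddEffectsMatch (D.dur d).st ∧ T.AddEffectsMatch (D.dur d).fin)
    -- the initial state satisfies the weight condition
    (hinit : ∀ γ : T.Instance O, γ.weight P.init ≤ 1)
    -- (i) not strongly safe pure durative schemas
    (h₁ : ∀ (d : D.Dur) (L : Finset _), T.IsClass (D.dur d).literals L →
      ¬ (D.dur d).PureStronglySafe T O L → (D.dur d).SimplySafeTypeA T O L)
    -- (ii) all other pure schemas: instantaneous ones, overall conditions, and the start and end
    -- fragments of strongly safe pure durative schemas
    (h₂inst : ∀ (i : D.Inst) (L : Finset _), T.IsClass (D.inst i).literals L →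
      ((D.inst i).restrict L).IrrelevantOrBalanced (Fintype.card O))
    (h₂inv : ∀ (d : D.Dur) (L : Finset _), T.IsClass (D.dur d).literals L →
      ((D.dur d).inv.restrict L).IrrelevantOrBalanced (Fintype.card O))
    (h₂dur : ∀ (d : D.Dur) (L : Finset _), T.IsClass (D.dur d).literals L →
      (D.dur d).PureStronglySafe T O L →
      ((D.dur d).st.restrict L).IrrelevantOrBalanced (Fintype.card O) ∧
      ((D.dur d).fin.restrict L).IrrelevantOrBalanced (Fintype.card O)) :
    T.IsInvariant D P := by
  intro γ
  -- Finiteness is what makes `ncard ≤ 1` mean at most one atom, as `ncard` is zero on infinite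
  -- sets.
  have := TemporalPlanning.atom_finite ar O
  refine TemporalPlanning.isMutexInvariantSet_of_balanced
    (fun p hp q hq => (Set.ncard_le_one_iff (Set.toFinite _)).1 (hinit γ) hp hq)
    (fun i gr => TemporalPlanning.ActionSchema.ground_balanced hrel (hinst i) (h₂inst i) gr γ)
    fun d gr => TemporalPlanning.DurativeSchema.ground_balanced_or_consumeProduce hrel (hdur d).1
      (hdur d).2 (h₁ d) (h₂dur d) gr γ
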